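/- Let $\rho>0$ and consider an initially empty $M/M/\infty$ queue with arrival rate $\rho$ and unit service rate. That is, let $\tau_0,\tau_1,\dots$ and $S_0,S_1,\dots$ be mutually independent random variables on a probability space, each $\tau_i$ exponentially distributed with rate $\rho$ and each $S_i$ exponentially distributed with rate $1$. Customer $i$ ($i=0,1,2,\dots$) arrives at time $T_i=\tau_0+\dots+\tau_i$, starts service immediately, and departs at time $T_i+S_i$. For $t\ge 0$ let $$D(t)=\#\{i\ge 0 : 0<T_i+S_i<t\}$$ be the number of departures in $(0,t)$. Then for every $t\ge 0$ the random variable $D(t)$ is almost surely finite and Poisson distributed with mean $\rho\,(e^{-t}-1+t)$, that is, $$\mathbb{P}(D(t)=k)=\frac{\rho^k\,(e^{-t}-1+t)^k}{k!}\,e^{-\rho(e^{-t}-1+t)},\qquad k=0,1,2,\dots$$ (for $t=0$ this is the point mass at $0$). -/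

import Mathlib

open MeasureTheory ProbabilityTheory

/-- The primitive data of an initially empty M/M/∞ queue with arrival rate `ρ` and unit service
rate, on a probability space `(Ω, P)`. Customers are numbered `0, 1, 2, …` in order of arrival;
`τ 0` is the time from the origin to the first arrival, `τ (i + 1)` is the time between the
arrivals of customers `i` and `i + 1`, and `S i` is the service time of customer `i`. The `τ i`
are exponential with rate `ρ` (so arrivals form a Poisson process of intensity `ρ`), the `S i`
are exponential with rate `1`, and all these variables are mutually independent. -/
structure IsMMInftyQueue {Ω : Type*} [MeasurableSpace Ω] (P : Measure Ω) (ρ : ℝ)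
    (τ S : ℕ → Ω → ℝ) : Prop where
  hasLaw_interarrival : ∀ i, HasLaw (τ i) (expMeasure ρ) P
  hasLaw_service : ∀ i, HasLaw (S i) (expMeasure 1) P
  mutual_indep : iIndepFun (Sum.elim τ S) P

namespace MMInfty

variable {Ω : Type*}

/-- The arrival time `τ 0 + ⋯ + τ i` of customer `i`. -/
def arrivalTime (τ : ℕ → Ω → ℝ) (i : ℕ) (ω : Ω) : ℝ :=
  ∑ j ∈ Finset.range (i + 1), τ j ω

/-- The departure time of customer `i`. There are infinitely many servers, so service starts
upon arrival, without waiting. -/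
def departureTime (τ S : ℕ → Ω → ℝ) (i : ℕ) (ω : Ω) : ℝ :=
  arrivalTime τ i ω + S i ω

/-- The number `D(t)` of departures in the time interval `(0, t)`, a priori possibly infinite. -/
noncomputable def departures (τ S : ℕ → Ω → ℝ) (t : ℝ) (ω : Ω) : ℕ∞ :=
  {i : ℕ | departureTime τ S i ω ∈ Set.Ioo 0 t}.encard

/-- The real number `ρ (e^{-t} - 1 + t)` as a nonnegative real, for `ρ ≥ 0`. -/
noncomputable def departureMean (ρ t : ℝ) (hρ : 0 ≤ ρ) : NNReal :=
  ⟨ρ * (Real.exp (-t) - 1 + t), mul_nonneg hρ (by linarith [Real.add_one_le_exp (-t)])⟩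

end MMInfty

/-! Condition on the first customer. If that customer arrives at time `a` and is served for time
`b`, the number of departures before `t` is `1` or `0`, according to whether `a + b < t`, plus the
number of departures before `t - a` in the queue formed by the other customers, which is independent
of the first customer and has the law of the original queue (`numDepartures_prepend`,
`measurePreserving_prepend`). Hence the probabilities `p k t` of exactly `k` departures before `t`
satisfy
`p k t = e^{-ρ t} (1{k = 0} + ∫₀ᵗ ρ e^{ρ u} ((1 - e^{-u}) p (k - 1) u + e^{-u} p k u) du)`,
with `p (-1) = 0` (`departureProb_renewal`). The right-hand side is continuous in `t`, so `p k` is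
continuous, so it is differentiable, and `p k' = ρ (1 - e^{-t}) (p (k - 1) - p k)`. As
`ρ (1 - e^{-t})` is the derivative of the mean `ρ (e^{-t} - 1 + t)`, the Poisson probabilities solve
the same equations with the same initial values, and uniqueness for linear equations
(`eq_of_renewal_equation`) gives the claim by induction on `k`. These probabilities sum to `1`, so
the number of departures is almost surely finite.

All this takes place on the sequence space of the primitive variables, whose law is determined by
the definition of the queue; the result is then transported to the given probability space. -/

namespace MMInfty

/-! ### Poisson probabilities and the renewal equation -/

theorem hasDerivAt_mean (ρ t : ℝ) :
    HasDerivAt (fun t : ℝ ↦ ρ * (Real.exp (-t) - 1 + t)) (ρ * (1 - Real.exp (-t))) t := by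
  have h := ((((hasDerivAt_id t).neg.exp).sub_const 1).add (hasDerivAt_id t)).const_mul ρ
  convert! h using 1
  simp only [Pi.neg_apply, id_eq]
  ring

/-- The probability that a Poisson variable with mean `ρ (e^{-t} - 1 + t)` equals `k`. -/
noncomputable def poissonWeight (ρ : ℝ) (k : ℕ) (t : ℝ) : ℝ :=
  Real.exp (-(ρ * (Real.exp (-t) - 1 + t))) * (ρ * (Real.exp (-t) - 1 + t)) ^ k / k.factorial

theorem poissonWeight_at_zero (ρ : ℝ) (k : ℕ) :
    poissonWeight ρ k 0 = if k = 0 then 1 else 0 := by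
  rcases k with _ | k <;> simp [poissonWeight]

theorem hasDerivAt_poissonWeight_zero (ρ t : ℝ) :
    HasDerivAt (poissonWeight ρ 0) (ρ * (1 - Real.exp (-t)) * (0 - poissonWeight ρ 0 t)) t := by
  have h := (hasDerivAt_mean ρ t).fun_neg.exp
  convert! h using 1
  · ext; simp [poissonWeight]
  · simp [poissonWeight]; ring

theorem hasDerivAt_poissonWeight_succ (ρ : ℝ) (k : ℕ) (t : ℝ) :
    HasDerivAt (poissonWeight ρ (k + 1))
      (ρ * (1 - Real.exp (-t)) * (poissonWeight ρ k t - poissonWeight ρ (k + 1) t)) t := by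
  have h := ((hasDerivAt_mean ρ t).fun_neg.exp.mul ((hasDerivAt_mean ρ t).fun_pow (k + 1))).div_const
    ((k + 1).factorial : ℝ)
  convert! h using 1
  simp only [poissonWeight, Nat.factorial_succ, Nat.add_sub_cancel]
  have : (k.factorial : ℝ) ≠ 0 := by positivity
  push_cast
  field_simp
  ring

/-- A bounded measurable solution of the renewal equation is determined on `[0, ∞)` by its forcing
term `h`. It is continuous there, being given by an integral of a bounded function, hence also
differentiable, and the renewal equation differentiates to `φ' = ρ (1 - e^{-t}) (h - φ)`. -/
theorem eq_of_renewal_equation {ρ A C : ℝ} {φ h ψ : ℝ → ℝ} (hφm : Measurable φ)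
    (hφb : ∀ u, |φ u| ≤ C) (hh : Continuous h)
    (hφ : ∀ t, 0 ≤ t → φ t = Real.exp (-(ρ * t)) * (A + ∫ u in (0 : ℝ)..t,
      ρ * Real.exp (ρ * u) * ((1 - Real.exp (-u)) * h u + Real.exp (-u) * φ u)))
    (hψ0 : ψ 0 = A)
    (hψ : ∀ t, HasDerivAt ψ (ρ * (1 - Real.exp (-t)) * (h t - ψ t)) t)
    {t : ℝ} (ht : 0 ≤ t) : φ t = ψ t := by
  let F : (ℝ → ℝ) → ℝ → ℝ := fun f u ↦
    ρ * Real.exp (ρ * u) * ((1 - Real.exp (-u)) * h u + Real.exp (-u) * f u)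
  let J : (ℝ → ℝ) → ℝ → ℝ := fun f t ↦
    Real.exp (-(ρ * t)) * (A + ∫ u in (0 : ℝ)..t, F f u)
  have hint : ∀ a b, IntervalIntegrable (F φ) volume a b := by
    intro a b
    have h1 : IntervalIntegrable φ volume a b := by
      refine (intervalIntegrable_const (c := C)).mono_fun hφm.aestronglyMeasurable ?_
      refine Filter.Eventually.of_forall fun u ↦ ?_
      simpa using (hφb u).trans (le_abs_self C)
    have h2 : IntervalIntegrable (fun u ↦ Real.exp (-u) * φ u) volume a b :=
      h1.continuousOn_mul (by fun_prop)
    have h3 : IntervalIntegrable (fun u ↦ (1 - Real.exp (-u)) * h u) volume a b :=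
      Continuous.intervalIntegrable (by fun_prop) a b
    exact (h3.add h2).continuousOn_mul (g := fun u ↦ ρ * Real.exp (ρ * u)) (by fun_prop)
  have hJc : Continuous (J φ) := by
    have := intervalIntegral.continuous_primitive hint 0
    fun_prop
  have hFc : Continuous (F (J φ)) := by fun_prop
  -- On `[0, ∞)` the functions `φ`, `J φ` and `J (J φ)` agree; the last one is differentiable.
  have hJJ : ∀ s, 0 ≤ s → J (J φ) s = φ s := by
    intro s hs
    rw [hφ s hs]
    simp only [J]
    congr 2
    refine intervalIntegral.integral_congr fun u hu ↦ ?_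
    rw [Set.uIcc_of_le hs] at hu
    simp only [F]
    rw [hφ u hu.1]
  have hder : ∀ s, 0 ≤ s →
      HasDerivAt (J (J φ)) (ρ * (1 - Real.exp (-s)) * (h s - J (J φ) s)) s := by
    intro s hs
    have h1 : HasDerivAt (fun t : ℝ ↦ Real.exp (-(ρ * t))) (Real.exp (-(ρ * s)) * -ρ) s := by
      simpa using ((hasDerivAt_id s).const_mul ρ).fun_neg.exp
    have h2 := (intervalIntegral.integral_hasDerivAt_right (hFc.intervalIntegrable 0 s)
      (hFc.stronglyMeasurableAtFilter _ _) hFc.continuousAt).const_add A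
    convert! h1.mul h2 using 1
    have e : J φ s = J (J φ) s := by rw [hJJ s hs, hφ s hs]
    have e2 : Real.exp (-(ρ * s)) * F (J φ) s
        = ρ * ((1 - Real.exp (-s)) * h s + Real.exp (-s) * J (J φ) s) := by
      simp only [F, e, Real.exp_neg (ρ * s)]
      field_simp
    rw [e2]
    have e3 : J (J φ) s = Real.exp (-(ρ * s)) * (A + ∫ u in (0 : ℝ)..s, F (J φ) u) := rfl
    have e4 : Real.exp (-(ρ * s)) * -ρ * (A + ∫ u in (0 : ℝ)..s, F (J φ) u)
        = -ρ * J (J φ) s := by rw [e3]; ring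
    rw [e4]
    ring
  -- The integrating factor turns the linear equation of the difference into `G' = 0`.
  let G : ℝ → ℝ := fun s ↦ (J (J φ) s - ψ s) * Real.exp (ρ * (Real.exp (-s) - 1 + s))
  have hG : ∀ s, 0 ≤ s → HasDerivAt G 0 s := by
    intro s hs
    convert! ((hder s hs).sub (hψ s)).mul (hasDerivAt_mean ρ s).exp using 1
    simp only [Pi.sub_apply]
    ring
  have h0 : G 0 = 0 := by simp [G, J, hψ0]
  have := constant_of_has_deriv_right_zero (a := 0) (b := t) (f := G)
    (fun s hs ↦ (hG s hs.1).continuousAt.continuousWithinAt)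
    (fun s hs ↦ (hG s hs.1).hasDerivWithinAt) t ⟨ht, le_rfl⟩
  rw [h0] at this
  simp only [G, mul_eq_zero, Real.exp_ne_zero, or_false] at this
  rw [← hJJ t ht]
  linarith

/-- The average of `g (t - a)` over an exponential time `a`, for bounded `g` equal to `A` on
`(-∞, 0]`. For `t ≥ 0`, the term with `A` is the contribution of `a ≥ t`. -/
theorem integral_sub_expMeasure {ρ A C : ℝ} (hρ : 0 < ρ) {g : ℝ → ℝ} (hg : Measurable g)
    (hb : ∀ u, |g u| ≤ C) (hA : ∀ u ≤ 0, g u = A) (t : ℝ) :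
    ∫ a, g (t - a) ∂(expMeasure ρ) =
      Real.exp (-(ρ * t)) * (A + ∫ u in (0 : ℝ)..t, ρ * Real.exp (ρ * u) * g u) := by
  have hI : ∀ s, IntegrableOn (fun u ↦ ρ * Real.exp (ρ * u) * g u) (Set.Iic s) := by
    intro s
    refine Integrable.mul_bdd (c := C) ((integrableOn_exp_mul_Iic hρ s).const_mul ρ)
      hg.aestronglyMeasurable (Filter.Eventually.of_forall hb)
  have h1 : ∫ a, g (t - a) ∂(expMeasure ρ) = ∫ a, exponentialPDFReal ρ a * g (t - a) := by
    change ∫ a, g (t - a) ∂(volume.withDensity (exponentialPDF ρ)) = _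
    rw [integral_withDensity_eq_integral_toReal_smul (f := exponentialPDF ρ)
      (measurable_exponentialPDFReal ρ).ennreal_ofReal
      (Filter.Eventually.of_forall fun _ ↦ ENNReal.ofReal_lt_top)]
    simp [exponentialPDF, ENNReal.toReal_ofReal (exponentialPDFReal_nonneg hρ _)]
  have h2 : ∀ u, exponentialPDFReal ρ (t - u) * g (t - (t - u)) =
      (Set.Iic t).indicator (fun u ↦ Real.exp (-(ρ * t)) * (ρ * Real.exp (ρ * u) * g u)) u := by
    intro u
    by_cases h : u ≤ t
    · have : Real.exp (-(ρ * (t - u))) = Real.exp (-(ρ * t)) * Real.exp (ρ * u) := by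
        rw [← Real.exp_add]; ring_nf
      simp [exponentialPDFReal, gammaPDFReal, h, this]
      ring
    · simp [exponentialPDFReal, gammaPDFReal, h]
  have h3 : ∫ u in Set.Iic (0 : ℝ), ρ * Real.exp (ρ * u) * g u = A := by
    rw [setIntegral_congr_fun measurableSet_Iic (g := fun u ↦ ρ * A * Real.exp (ρ * u))
      (fun u hu ↦ by simp only [hA u hu]; ring), integral_const_mul, integral_exp_mul_Iic hρ]
    simp; field_simp
  rw [h1, ← integral_sub_left_eq_self _ volume t, integral_congr_ae
    (Filter.Eventually.of_forall h2), integral_indicator measurableSet_Iic, integral_const_mul,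
    ← intervalIntegral.integral_Iic_sub_Iic (hI 0) (hI t), h3]
  ring

/-! ### The queue on the sequence space -/

/-- The laws of the primitive variables: `Sum.inl i` indexes the interarrival time `τ i` and
`Sum.inr i` the service time `S i`. -/
noncomputable def primitiveLaw (ρ : ℝ) : ℕ ⊕ ℕ → Measure ℝ :=
  Sum.elim (fun _ ↦ expMeasure ρ) (fun _ ↦ expMeasure 1)

/-- The joint law of all interarrival and service times on the sequence space `ℕ ⊕ ℕ → ℝ`. -/
noncomputable def queueLaw (ρ : ℝ) : Measure (ℕ ⊕ ℕ → ℝ) :=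
  Measure.infinitePi (primitiveLaw ρ)

theorem isProbabilityMeasure_primitiveLaw {ρ : ℝ} (hρ : 0 < ρ) (j : ℕ ⊕ ℕ) :
    IsProbabilityMeasure (primitiveLaw ρ j) := by
  rcases j with _ | _
  · exact isProbabilityMeasure_expMeasure hρ
  · exact isProbabilityMeasure_expMeasure one_pos

theorem isProbabilityMeasure_queueLaw {ρ : ℝ} (hρ : 0 < ρ) :
    IsProbabilityMeasure (queueLaw ρ) := by
  have := isProbabilityMeasure_primitiveLaw hρ
  unfold queueLaw
  infer_instance

/-- The departure time of customer `i` as a function of the primitive variables. -/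
noncomputable def seqDepartureTime (i : ℕ) (x : ℕ ⊕ ℕ → ℝ) : ℝ :=
  departureTime (fun j y ↦ y (Sum.inl j)) (fun j (y : ℕ ⊕ ℕ → ℝ) ↦ y (Sum.inr j)) i x

/-- The number of departures before `t`, including those at times `≤ 0`. For positive primitive
variables there are none of the latter; counting them makes `numDepartures_prepend` hold without
exception. -/
noncomputable def numDepartures (t : ℝ) (x : ℕ ⊕ ℕ → ℝ) : ℕ∞ :=
  {i : ℕ | seqDepartureTime i x < t}.encard

/-- The queue with a first customer arriving at time `a` and served for time `b`, followed by the
queue `y` delayed by `a`. -/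
def prepend (p : ℝ × ℝ) (y : ℕ ⊕ ℕ → ℝ) : ℕ ⊕ ℕ → ℝ
  | Sum.inl 0 => p.1
  | Sum.inl (i + 1) => y (Sum.inl i)
  | Sum.inr 0 => p.2
  | Sum.inr (i + 1) => y (Sum.inr i)

theorem measurable_prepend :
    Measurable (fun q : (ℝ × ℝ) × (ℕ ⊕ ℕ → ℝ) ↦ prepend q.1 q.2) := by
  refine measurable_pi_iff.2 ?_
  rintro ((_ | i) | (_ | i)) <;> simp only [prepend] <;> fun_prop

@[fun_prop]
theorem measurable_seqDepartureTime (i : ℕ) : Measurable (seqDepartureTime i) := by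
  unfold seqDepartureTime departureTime arrivalTime
  fun_prop

theorem measurable_numDepartures_uncurry :
    Measurable (fun q : ℝ × (ℕ ⊕ ℕ → ℝ) ↦ numDepartures q.1 q.2) := by
  refine measurable_encard.comp (measurable_set_iff.2 fun i ↦ ?_)
  exact measurableSet_setOfPred.1 (measurableSet_lt (by fun_prop) measurable_fst)

theorem measurable_numDepartures (t : ℝ) : Measurable (numDepartures t) :=
  Measurable.of_uncurry_left (f := numDepartures) measurable_numDepartures_uncurry

theorem seqDepartureTime_prepend_zero (p : ℝ × ℝ) (y : ℕ ⊕ ℕ → ℝ) :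
    seqDepartureTime 0 (prepend p y) = p.1 + p.2 := by
  simp [seqDepartureTime, departureTime, arrivalTime, prepend]

theorem seqDepartureTime_prepend_succ (p : ℝ × ℝ) (y : ℕ ⊕ ℕ → ℝ) (i : ℕ) :
    seqDepartureTime (i + 1) (prepend p y) = p.1 + seqDepartureTime i y := by
  simp only [seqDepartureTime, departureTime, arrivalTime]
  rw [Finset.sum_range_succ']
  simp only [prepend]
  ring

/-! ### Renewal at the first arrival -/

/-- The renewal decomposition at the first arrival. -/
theorem numDepartures_prepend (t : ℝ) (p : ℝ × ℝ) (y : ℕ ⊕ ℕ → ℝ) :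
    numDepartures t (prepend p y) =
      (if p.2 < t - p.1 then 1 else 0) + numDepartures (t - p.1) y := by
  have h : {i : ℕ | seqDepartureTime i (prepend p y) < t} =
      (if p.2 < t - p.1 then {0} else ∅) ∪
        Nat.succ '' {i : ℕ | seqDepartureTime i y < t - p.1} := by
    ext i
    rcases i with _ | i
    · rw [Set.mem_ofPred_eq, seqDepartureTime_prepend_zero, ← lt_sub_iff_add_lt']
      split_ifs with h <;> simp [h]
    · rw [Set.mem_ofPred_eq, seqDepartureTime_prepend_succ, ← lt_sub_iff_add_lt']
      split_ifs with h <;> simp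
  rw [numDepartures, h, Set.encard_union_eq, Nat.succ_injective.encard_image, numDepartures]
  · split_ifs <;> simp
  · split_ifs <;> simp

/-- Prepending an independent customer to the canonical queue gives the canonical queue. -/
theorem measurePreserving_prepend {ρ : ℝ} (hρ : 0 < ρ) :
    MeasurePreserving (fun q : (ℝ × ℝ) × (ℕ ⊕ ℕ → ℝ) ↦ prepend q.1 q.2)
      (((expMeasure ρ).prod (expMeasure 1)).prod (queueLaw ρ)) (queueLaw ρ) := by
  have := isProbabilityMeasure_primitiveLaw hρ
  have := isProbabilityMeasure_queueLaw hρ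
  have := isProbabilityMeasure_expMeasure hρ
  have := isProbabilityMeasure_expMeasure one_pos
  refine ⟨measurable_prepend, Measure.eq_infinitePi _ fun s t ht ↦ ?_⟩
  -- Enlarge `s` to `{0, …, n} ⊕ {0, …, n}`, with trivial constraints at the new indices.
  obtain ⟨n, hn⟩ : ∃ n : ℕ, s ⊆ (Finset.range (n + 1)).disjSum (Finset.range (n + 1)) := by
    refine ⟨s.sup (Sum.elim id id), fun j hj ↦ ?_⟩
    have := Finset.le_sup (f := Sum.elim id id) hj
    rcases j with i | i <;> simp_all
  let t' : ℕ ⊕ ℕ → Set ℝ := fun j ↦ if j ∈ s then t j else Set.univ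
  have ht' : ∀ j, MeasurableSet (t' j) := by
    intro j
    simp only [t']
    split_ifs
    exacts [ht j, .univ]
  have h1 : Set.pi (s : Set (ℕ ⊕ ℕ)) t =
      Set.pi ((Finset.range (n + 1)).disjSum (Finset.range (n + 1)) : Finset (ℕ ⊕ ℕ)) t' := by
    ext x
    simp only [Set.mem_pi, Finset.mem_coe, t']
    refine ⟨fun h j _ ↦ ?_, fun h j hj ↦ by simpa [hj] using h j (hn hj)⟩
    split_ifs with hj
    exacts [h j hj, trivial]
  have h2 : ∏ j ∈ s, primitiveLaw ρ j (t j) =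
      ∏ j ∈ (Finset.range (n + 1)).disjSum (Finset.range (n + 1)), primitiveLaw ρ j (t' j) := by
    rw [← Finset.prod_subset hn fun j _ hj ↦ by simp [t', hj]]
    exact Finset.prod_congr rfl fun j hj ↦ by simp [t', hj]
  have h3 : (fun q : (ℝ × ℝ) × (ℕ ⊕ ℕ → ℝ) ↦ prepend q.1 q.2) ⁻¹'
      Set.pi ((Finset.range (n + 1)).disjSum (Finset.range (n + 1)) : Finset (ℕ ⊕ ℕ)) t' =
      (t' (Sum.inl 0) ×ˢ t' (Sum.inr 0)) ×ˢ
        Set.pi ((Finset.range n).disjSum (Finset.range n) : Finset (ℕ ⊕ ℕ))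
          (Sum.elim (fun i ↦ t' (Sum.inl (i + 1))) fun i ↦ t' (Sum.inr (i + 1))) := by
    ext ⟨⟨a, b⟩, y⟩
    simp only [Set.mem_preimage, Set.mem_pi, Finset.mem_coe, Set.mem_prod, Sum.forall,
      Finset.inl_mem_disjSum, Finset.inr_mem_disjSum, Finset.mem_range, Sum.elim_inl,
      Sum.elim_inr, Nat.forall_lt_succ_left', prepend]
    tauto
  rw [h1, h2, Measure.map_apply measurable_prepend (.pi (Finset.countable_toSet _) fun j _ ↦ ht' j),
    h3, Measure.prod_prod, Measure.prod_prod, queueLaw, Measure.infinitePi_pi]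
  · rw [Finset.prod_disjSum, Finset.prod_disjSum, Finset.prod_range_succ', Finset.prod_range_succ']
    simp only [Sum.elim_inl, Sum.elim_inr, primitiveLaw]
    ring
  · rintro (i | i) _ <;> exact ht' _

theorem measurableSet_numDepartures_eq (t : ℝ) (k : ℕ∞) :
    MeasurableSet {x | numDepartures t x = k} :=
  measurable_numDepartures t (measurableSet_singleton k)

theorem measurable_queueLaw_numDepartures_eq {ρ : ℝ} (hρ : 0 < ρ) (k : ℕ∞) :
    Measurable fun t ↦ queueLaw ρ {x | numDepartures t x = k} := by
  have := isProbabilityMeasure_queueLaw hρ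
  exact measurable_measure_prodMk_left
    (measurable_numDepartures_uncurry (measurableSet_singleton k))

theorem ae_queueLaw_pos {ρ : ℝ} (hρ : 0 < ρ) : ∀ᵐ x ∂queueLaw ρ, ∀ j, 0 < x j := by
  have := isProbabilityMeasure_primitiveLaw hρ
  have hexp : ∀ r : ℝ, 0 < r → ∀ᵐ a ∂expMeasure r, 0 < a := by
    intro r hr
    have := isProbabilityMeasure_expMeasure hr
    rw [ae_iff]
    have h : (expMeasure r).real (Set.Iic 0) = 0 := by
      rw [← cdf_eq_real, cdf_expMeasure_eq hr]
      simp
    rw [measureReal_eq_zero_iff] at h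
    simpa [Set.Iic] using h
  refine ae_all_iff.2 fun j ↦ ?_
  refine (measurePreserving_eval_infinitePi (primitiveLaw ρ) j).quasiMeasurePreserving.ae
    (p := fun a ↦ 0 < a) ?_
  rcases j with _ | _
  exacts [hexp ρ hρ, hexp 1 one_pos]

theorem seqDepartureTime_pos {x : ℕ ⊕ ℕ → ℝ} (hx : ∀ j, 0 < x j) (i : ℕ) :
    0 < seqDepartureTime i x :=
  add_pos (Finset.sum_pos (fun _ _ ↦ hx _) (by simp)) (hx _)

theorem measureReal_expMeasure_Iio {u : ℝ} (hu : 0 ≤ u) :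
    (expMeasure 1).real (Set.Iio u) = 1 - Real.exp (-u) := by
  have := isProbabilityMeasure_expMeasure one_pos
  have h : (expMeasure 1) {u} = 0 :=
    (withDensity_absolutelyContinuous volume (gammaPDF 1 1)) (measure_singleton u)
  have h2 : (expMeasure 1).real (Set.Iio u) = (expMeasure 1).real (Set.Iic u) := by
    refine measureReal_congr ?_
    rw [← Set.Iio_union_right]
    exact (union_ae_eq_left_of_ae_eq_empty (ae_eq_empty.2 h)).symm
  rw [h2, ← cdf_eq_real, cdf_expMeasure_eq one_pos, if_pos hu, one_mul]

/-! ### The probabilities of `k` departures -/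

/-- The probability that exactly `k` customers have departed before `t`. -/
noncomputable def departureProb (ρ : ℝ) (k : ℕ) (t : ℝ) : ℝ :=
  (queueLaw ρ).real {x | numDepartures t x = k}

theorem measurable_departureProb {ρ : ℝ} (hρ : 0 < ρ) (k : ℕ) : Measurable (departureProb ρ k) :=
  (measurable_queueLaw_numDepartures_eq hρ k).ennreal_toReal

theorem departureProb_nonneg (ρ : ℝ) (k : ℕ) (t : ℝ) : 0 ≤ departureProb ρ k t :=
  measureReal_nonneg

theorem departureProb_le_one {ρ : ℝ} (hρ : 0 < ρ) (k : ℕ) (t : ℝ) : departureProb ρ k t ≤ 1 :=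
  have := isProbabilityMeasure_queueLaw hρ
  measureReal_le_one

theorem departureProb_of_nonpos {ρ : ℝ} (hρ : 0 < ρ) (k : ℕ) {t : ℝ} (ht : t ≤ 0) :
    departureProb ρ k t = if k = 0 then 1 else 0 := by
  have := isProbabilityMeasure_queueLaw hρ
  have h : ∀ᵐ x ∂queueLaw ρ, numDepartures t x = 0 := by
    filter_upwards [ae_queueLaw_pos hρ] with x hx
    simp only [numDepartures, Set.encard_eq_zero, Set.eq_empty_iff_forall_notMem,
      Set.mem_ofPred_eq, not_lt]
    exact fun i ↦ ht.trans (seqDepartureTime_pos hx i).le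
  have h2 : departureProb ρ k t = (queueLaw ρ).real {_x | (0 : ℕ∞) = k} := by
    refine measureReal_congr ?_
    filter_upwards [h] with x hx
    change (numDepartures t x = k) = ((0 : ℕ∞) = k)
    rw [hx]
  rw [h2]
  rcases k with _ | k
  · simp
  · have : (0 : ℕ∞) ≠ ((k + 1 : ℕ) : ℕ∞) := by exact_mod_cast (Nat.succ_ne_zero k).symm
    simp only [this, Set.ofPred_false, measureReal_empty, Nat.succ_ne_zero, if_false]

/-- The probability of exactly `k - 1` departures before `t`, equal to `0` for `k = 0`: the chance
of `k` departures in total when one further customer is known to have departed. -/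
noncomputable def departureProbPred (ρ : ℝ) : ℕ → ℝ → ℝ
  | 0 => 0
  | k + 1 => departureProb ρ k

theorem measureReal_one_add_numDepartures_eq (ρ : ℝ) (k : ℕ) (u : ℝ) :
    (queueLaw ρ).real {y | 1 + numDepartures u y = k} = departureProbPred ρ k u := by
  rcases k with _ | k
  · simp [departureProbPred]
  · have : ∀ y, 1 + numDepartures u y = (k + 1 : ℕ) ↔ numDepartures u y = k := by
      intro y
      rw [add_comm, Nat.cast_succ]
      exact (ENat.add_left_injective_of_ne_top (n := 1) (by simp)).eq_iff
    simp only [this, departureProbPred, departureProb]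

/-- Conditioning on the arrival time `a` of the first customer, who departs before `t` with
probability `P(S < t - a)`. -/
theorem departureProb_eq_integral {ρ : ℝ} (hρ : 0 < ρ) (k : ℕ) (t : ℝ) :
    departureProb ρ k t = ∫ a, ((expMeasure 1).real (Set.Iio (t - a)) *
      departureProbPred ρ k (t - a) + (1 - (expMeasure 1).real (Set.Iio (t - a))) *
      departureProb ρ k (t - a)) ∂(expMeasure ρ) := by
  have := isProbabilityMeasure_queueLaw hρ
  have := isProbabilityMeasure_expMeasure hρ
  have := isProbabilityMeasure_expMeasure one_pos
  let s : Set ((ℝ × ℝ) × (ℕ ⊕ ℕ → ℝ)) :=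
    (fun q ↦ prepend q.1 q.2) ⁻¹' {x | numDepartures t x = k}
  have hs : MeasurableSet s := measurable_prepend (measurableSet_numDepartures_eq t k)
  have h1 : departureProb ρ k t =
      (((expMeasure ρ).prod (expMeasure 1)).prod (queueLaw ρ)).real s := by
    rw [departureProb, measureReal_def, measureReal_def,
      (measurePreserving_prepend hρ).measure_preimage
        (measurableSet_numDepartures_eq t k).nullMeasurableSet]
  have hm : Measurable fun p : ℝ × ℝ ↦ (queueLaw ρ).real (Prod.mk p ⁻¹' s) :=
    (measurable_measure_prodMk_left hs).ennreal_toReal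
  have hi : Integrable (fun p : ℝ × ℝ ↦ (queueLaw ρ).real (Prod.mk p ⁻¹' s))
      ((expMeasure ρ).prod (expMeasure 1)) :=
    .of_bound hm.aestronglyMeasurable 1 (Filter.Eventually.of_forall fun p ↦ by
      rw [Real.norm_of_nonneg measureReal_nonneg]; exact measureReal_le_one)
  rw [h1, measureReal_def, Measure.prod_apply hs, ← integral_toReal
    (measurable_measure_prodMk_left hs).aemeasurable
    (Filter.Eventually.of_forall fun p ↦ measure_lt_top _ _)]
  change ∫ p, (queueLaw ρ).real (Prod.mk p ⁻¹' s) ∂_ = _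
  rw [integral_prod _ hi]
  congr 1 with a
  have h2 : ∀ b, (queueLaw ρ).real (Prod.mk (a, b) ⁻¹' s) =
      (Set.Iio (t - a)).indicator (fun _ ↦ departureProbPred ρ k (t - a)) b +
      (Set.Iio (t - a))ᶜ.indicator (fun _ ↦ departureProb ρ k (t - a)) b := by
    intro b
    have : Prod.mk (a, b) ⁻¹' s =
        {y | (if b < t - a then 1 else 0) + numDepartures (t - a) y = k} := by
      ext y
      simp [s, numDepartures_prepend]
    rw [this]
    by_cases hb : b < t - a
    · simpa [hb, not_le.2 hb] using measureReal_one_add_numDepartures_eq ρ k (t - a)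
    · simp [hb, not_lt.1 hb, departureProb]
  simp_rw [h2]
  rw [integral_add ((integrable_const _).indicator measurableSet_Iio)
    ((integrable_const _).indicator measurableSet_Iio.compl),
    integral_indicator_const _ measurableSet_Iio, integral_indicator_const _ measurableSet_Iio.compl,
    probReal_compl_eq_one_sub measurableSet_Iio]
  simp

/-- The renewal equation for `departureProb`. -/
theorem departureProb_renewal {ρ : ℝ} (hρ : 0 < ρ) (k : ℕ) {t : ℝ} (ht : 0 ≤ t) :
    departureProb ρ k t = Real.exp (-(ρ * t)) * ((if k = 0 then 1 else 0) +
      ∫ u in (0 : ℝ)..t, ρ * Real.exp (ρ * u) * ((1 - Real.exp (-u)) * departureProbPred ρ k u +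
        Real.exp (-u) * departureProb ρ k u)) := by
  have := isProbabilityMeasure_expMeasure one_pos
  let c : ℝ → ℝ := fun u ↦ (expMeasure 1).real (Set.Iio u)
  have hc : ∀ u ≤ 0, c u = 0 := by
    intro u hu
    have h0 : c 0 = 0 := by simpa using measureReal_expMeasure_Iio le_rfl
    exact le_antisymm (h0 ▸ measureReal_mono (Set.Iio_subset_Iio hu)) measureReal_nonneg
  have hc0 : ∀ u, 0 ≤ c u := fun u ↦ measureReal_nonneg
  have hc1 : ∀ u, c u ≤ 1 := fun u ↦ measureReal_le_one
  have hcm : Measurable c :=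
    Monotone.measurable fun u v huv ↦ measureReal_mono (Set.Iio_subset_Iio huv)
  have hqm : Measurable (departureProbPred ρ k) := by
    rcases k with _ | k
    exacts [measurable_const, measurable_departureProb hρ k]
  have hq0 : ∀ u, 0 ≤ departureProbPred ρ k u := by
    rcases k with _ | k
    exacts [fun _ ↦ le_rfl, departureProb_nonneg ρ k]
  have hq1 : ∀ u, departureProbPred ρ k u ≤ 1 := by
    rcases k with _ | k
    exacts [fun _ ↦ zero_le_one, departureProb_le_one hρ k]
  have hp0 := departureProb_nonneg ρ k
  have hp1 := departureProb_le_one hρ k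
  have hpm := measurable_departureProb hρ k
  rw [departureProb_eq_integral hρ,
    integral_sub_expMeasure hρ (C := 1) (A := if k = 0 then 1 else 0)
      (g := fun u ↦ c u * departureProbPred ρ k u + (1 - c u) * departureProb ρ k u)
      (by fun_prop)]
  · congr 2
    refine intervalIntegral.integral_congr fun u hu ↦ ?_
    rw [Set.uIcc_of_le ht] at hu
    simp only [c, measureReal_expMeasure_Iio hu.1]
    ring
  · intro u
    have := hc0 u; have := hc1 u; have := hq0 u; have := hq1 u; have := hp0 u; have := hp1 u
    rw [abs_le]
    constructor <;> nlinarith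
  · intro u hu
    simp [hc u hu, departureProb_of_nonpos hρ k hu]

theorem departureProb_eq_poissonWeight {ρ : ℝ} (hρ : 0 < ρ) (k : ℕ) {t : ℝ} (ht : 0 ≤ t) :
    departureProb ρ k t = poissonWeight ρ k t := by
  have hb : ∀ k u, |departureProb ρ k u| ≤ 1 := fun k u ↦ by
    rw [abs_of_nonneg (departureProb_nonneg ρ k u)]
    exact departureProb_le_one hρ k u
  induction k generalizing t with
  | zero =>
    exact eq_of_renewal_equation (measurable_departureProb hρ 0) (hb 0) (h := fun _ ↦ 0)
      continuous_const (fun s hs ↦ departureProb_renewal hρ 0 hs) (poissonWeight_at_zero ρ 0)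
      (hasDerivAt_poissonWeight_zero ρ) ht
  | succ k ih =>
    refine eq_of_renewal_equation (measurable_departureProb hρ (k + 1)) (hb (k + 1))
      (h := poissonWeight ρ k) (by unfold poissonWeight; fun_prop) (fun s hs ↦ ?_)
      (poissonWeight_at_zero ρ (k + 1)) (hasDerivAt_poissonWeight_succ ρ k) ht
    rw [departureProb_renewal hρ (k + 1) hs]
    congr 2
    refine intervalIntegral.integral_congr fun u hu ↦ ?_
    rw [Set.uIcc_of_le hs] at hu
    simp only [departureProbPred, ih hu.1]

/-! ### The law of the number of departures -/

/-- Two probability measures on `ℕ∞`, the second of which is carried by `ℕ`, agree if they do so on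
each natural number: no mass is left for `⊤`. -/
theorem ext_of_natCast_singleton {μ : Measure ℕ∞} {ν : Measure ℕ} [IsProbabilityMeasure μ]
    [IsProbabilityMeasure ν] (h : ∀ k : ℕ, μ {(k : ℕ∞)} = ν {k}) :
    μ = ν.map (Nat.cast : ℕ → ℕ∞) := by
  have hm : Measurable (Nat.cast : ℕ → ℕ∞) := measurable_from_top
  have := Measure.isProbabilityMeasure_map (μ := ν) hm.aemeasurable
  have h' : ∀ k : ℕ, μ {(k : ℕ∞)} = ν.map (Nat.cast : ℕ → ℕ∞) {(k : ℕ∞)} := by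
    intro k
    rw [h, Measure.map_apply hm (measurableSet_singleton _)]
    congr 1
    ext; simp
  have htop : ({⊤} : Set ℕ∞) = (⋃ k : ℕ, {(k : ℕ∞)})ᶜ := by
    ext n
    cases n <;> simp
  refine Measure.ext_of_singleton fun n ↦ ?_
  cases n with
  | coe k => exact h' k
  | top =>
    have hd : Pairwise (Function.onFun Disjoint fun k : ℕ ↦ ({(k : ℕ∞)} : Set ℕ∞)) :=
      fun i j hij ↦ by simpa [Function.onFun] using hij
    rw [htop, prob_compl_eq_one_sub (.iUnion fun _ ↦ measurableSet_singleton _),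
      prob_compl_eq_one_sub (.iUnion fun _ ↦ measurableSet_singleton _),
      measure_iUnion hd fun _ ↦ measurableSet_singleton _,
      measure_iUnion hd fun _ ↦ measurableSet_singleton _]
    simp_rw [h']

theorem hasLaw_numDepartures {ρ : ℝ} (hρ : 0 < ρ) {t : ℝ} (ht : 0 ≤ t) :
    HasLaw (numDepartures t)
      ((poissonMeasure (departureMean ρ t hρ.le)).map (Nat.cast : ℕ → ℕ∞)) (queueLaw ρ) := by
  have := isProbabilityMeasure_queueLaw hρ
  have hm := measurable_numDepartures t
  have := Measure.isProbabilityMeasure_map (μ := queueLaw ρ) hm.aemeasurable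
  refine ⟨hm.aemeasurable, ext_of_natCast_singleton fun k ↦ ?_⟩
  rw [Measure.map_apply hm (measurableSet_singleton _), poissonMeasure_singleton]
  change queueLaw ρ {x | numDepartures t x = k} = ENNReal.ofReal (poissonWeight ρ k t)
  rw [← departureProb_eq_poissonWeight hρ k ht, departureProb, ofReal_measureReal]

end MMInfty

theorem mainTheorem1 {Ω : Type*} [MeasurableSpace Ω] (P : Measure Ω) [IsProbabilityMeasure P]
    (ρ : ℝ) (hρ : 0 < ρ) (τ S : ℕ → Ω → ℝ) (hQ : IsMMInftyQueue P ρ τ S)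
    (t : ℝ) (ht : 0 ≤ t) :
    HasLaw (MMInfty.departures τ S t)
      ((poissonMeasure (MMInfty.departureMean ρ t hρ.le)).map (Nat.cast : ℕ → ℕ∞)) P := by
  have hlaw : HasLaw (fun ω j ↦ Sum.elim τ S j ω) (MMInfty.queueLaw ρ) P := by
    have h : ∀ j, HasLaw (Sum.elim τ S j) (MMInfty.primitiveLaw ρ j) P := by
      rintro (i | i)
      exacts [hQ.hasLaw_interarrival i, hQ.hasLaw_service i]
    exact hQ.mutual_indep.hasLaw_infinitePi h
      (aemeasurable_pi_iff.2 fun j ↦ (h j).aemeasurable)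
  refine ((MMInfty.hasLaw_numDepartures hρ ht).comp hlaw).congr ?_
  filter_upwards [ae_of_ae_map hlaw.aemeasurable
    (hlaw.map_eq.symm ▸ MMInfty.ae_queueLaw_pos hρ)] with ω hω
  -- Primitive variables are almost surely positive, so all departures occur after time `0`.
  have hpos := MMInfty.seqDepartureTime_pos hω
  change Set.encard _ = Set.encard _
  congr 1
  ext i
  exact ⟨fun h ↦ h.2, fun h ↦ ⟨hpos i, h⟩⟩
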